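/- Let $\mathbb{H}=\mathbb{R}^3$ be the Heisenberg group with left-invariant vector fields $X=\partial_x-\frac y2\partial_z$ and $Y=\partial_y+\frac x2\partial_z$. For $p\in\{1,\infty\}$ let $$d_p(g_0,g_1)=\inf\int_0^1\|(u_1(t),u_2(t))\|_p\,dt,$$ the infimum being over absolutely continuous curves $\gamma:[0,1]\to\mathbb{H}$ from $g_0$ to $g_1$ with $\dot\gamma=u_1X(\gamma)+u_2Y(\gamma)$ a.e., where $\|u\|_1=|u_1|+|u_2|$ and $\|u\|_\infty=\max(|u_1|,|u_2|)$. Let $\mathfrak m$ be the Lebesgue measure on $\mathbb{H}$. By a geodesic of a metric space $(M,d)$ we mean a constant speed minimising geodesic, i.e. $\gamma:[0,1]\to M$ with $d(\gamma(s),\gamma(t))=|t-s|\,d(\gamma(0),\gamma(1))$. For $K\in\mathbb{R}$ and $N\ge1$, a geodesic metric measure space $(M,d,\mathfrak m)$ satisfies $\mathsf{MCP}(K,N)$ (Ohta) if for all $x\in M$ and all measurable $A$ with $0<\mathfrak m(A)<\infty$ (and $A\subseteq B(x,\pi\sqrt{(N-1)/K})$ if $K>0$ and $N>1$) there is a probability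 measure $\Pi$ on the space of geodesics such that $(e_0)_*\Pi=\delta_x$, $(e_1)_*\Pi=\mathfrak m|_A/\mathfrak m(A)$ and, for all $t\in[0,1]$, $$(e_t)_*\Big(t\Big[\frac{\mathsf s_K(t\,\ell(\gamma)/\sqrt{N-1})}{\mathsf s_K(\ell(\gamma)/\sqrt{N-1})}\Big]^{N-1}\mathfrak m(A)\,d\Pi(\gamma)\Big)\le d\mathfrak m .$$ Here $e_t(\gamma)=\gamma(t)$, $\ell(\gamma)=d(\gamma(0),\gamma(1))$, and $\mathsf s_K(r)$ is $\sin(\sqrt Kr)/\sqrt K$, $r$, or $\sinh(\sqrt{-K}r)/\sqrt{-K}$ according to whether $K>0$, $K=0$ or $K<0$. The bracket to the power $N-1$ is read as $1$ when $\ell(\gamma)=0$ or when $N=1$, $K\le0$; in the degenerate case $N=1$, $K>0$ it is read as $+\infty$ when $\ell(\gamma)>0$. **Theorem.** For $p=1$ and for $p=\infty$, the $\ell^p$-Heisenberg group $(\mathbb{H},d_p,\mathfrak m)$ does not satisfy $\mathsf{MCP}(K,N)$ for any $K\in\mathbb{R}$ and any $N\ge1$. Moreover, there is a bounded Borel set $\Omega\subseteq\mathbb{H}$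 with $0<\mathfrak m(\Omega)<\infty$ such that for every $t\in[0,\frac18]$ the $t$-intermediate set $\Omega_t=\{\gamma(t)\mid\gamma\text{ geodesic},\ \gamma(0)=(0,0,0),\ \gamma(1)\in\Omega\}$ satisfies $\mathfrak m(\Omega_t)=0$. -/

import Mathlib

open MeasureTheory Set
open scoped ENNReal

noncomputable section

/-! ### The measure contraction property of a metric measure space -/

section MCP

variable {X : Type*}

/-- `γ : [0,1] → X` is a constant speed minimising geodesic for the distance `d`. -/
def IsMinGeodesic (d : X → X → ℝ≥0∞) (γ : unitInterval → X) : Prop :=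
  d (γ 0) (γ 1) ≠ ∞ ∧
    ∀ s t : unitInterval, d (γ s) (γ t) = ENNReal.ofReal |(t : ℝ) - s| * d (γ 0) (γ 1)

/-- The space of constant speed minimising geodesics.  As a subtype of `[0,1] → X` it carries the
σ-algebra generated by the evaluations `γ ↦ γ t`; for a separable metric space this is the Borel
σ-algebra of the topology of uniform convergence. -/
abbrev GeodesicSpace (d : X → X → ℝ≥0∞) : Type _ := {γ : unitInterval → X // IsMinGeodesic d γ}

/-- The `t`-intermediate set `Ω_t` of `Ω` from the point `x`. -/
def intermediateSet (d : X → X → ℝ≥0∞) (x : X) (Ω : Set X) (t : unitInterval) : Set X :=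
  {y | ∃ γ : unitInterval → X, IsMinGeodesic d γ ∧ γ 0 = x ∧ γ 1 ∈ Ω ∧ γ t = y}

/-- The generalised sine `s_K`, solution of `s'' + K s = 0`, `s(0) = 0`, `s'(0) = 1`. -/
def genSin (K r : ℝ) : ℝ :=
  if 0 < K then Real.sin (√K * r) / √K
  else if K = 0 then r
  else Real.sinh (√(-K) * r) / √(-K)

/-- The factor `[s_K(tθ/√(N-1)) / s_K(θ/√(N-1))]^(N-1)`, with the conventions `0/0 = 1`, and
value `1` if `N = 1` and `K ≤ 0`.  In the degenerate case `N = 1`, `K > 0` (where all distances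
`θ > 0` exceed the maximal diameter `π √((N-1)/K) = 0`) the value is `+∞` for `θ > 0`. -/
def mcpFactor (K N t θ : ℝ) : ℝ≥0∞ :=
  if θ = 0 then 1
  else if N = 1 then (if K ≤ 0 then 1 else ∞)
  else ENNReal.ofReal ((genSin K (t * θ / √(N - 1)) / genSin K (θ / √(N - 1))) ^ (N - 1))

/-- The measure contraction property `MCP(K, N)` (Ohta's definition, `N ≥ 1`), valid without any
assumption on the cut locus: for every `x` and every measurable `A` with `0 < μ(A) < ∞` (and
`A ⊆ B(x, π √((N-1)/K))` if `K > 0` and `N > 1`) there is a probability measure `P` on the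
geodesics, with `(e_0)_* P = δ_x` and `(e_1)_* P = μ|_A / μ(A)`, such that for all `t ∈ [0,1]`
`(e_t)_* ( t [s_K(t ℓ(γ)/√(N-1)) / s_K(ℓ(γ)/√(N-1))]^(N-1) μ(A) dP(γ) ) ≤ dμ`,
where `ℓ(γ) = d(γ(0), γ(1))`. -/
def MCP [MeasurableSpace X] (d : X → X → ℝ≥0∞) (μ : Measure X) (K N : ℝ) : Prop :=
  ∀ (x : X) (A : Set X), MeasurableSet A → 0 < μ A → μ A < ∞ →
    (0 < K → 1 < N → ∀ y ∈ A, d x y < ENNReal.ofReal (Real.pi * √((N - 1) / K))) →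
    ∃ P : Measure (GeodesicSpace d), IsProbabilityMeasure P ∧
      P.map (fun γ => γ.1 0) = Measure.dirac x ∧
      P.map (fun γ => γ.1 1) = (μ A)⁻¹ • μ.restrict A ∧
      ∀ t : unitInterval,
        (P.withDensity fun γ =>
            ENNReal.ofReal t * mcpFactor K N t (d (γ.1 0) (γ.1 1)).toReal * μ A).map
          (fun γ => γ.1 t) ≤ μ

end MCP

/-! ### The `ℓ^p`-Heisenberg group -/

/-- The Heisenberg group in exponential coordinates, `ℝ³` with the group law
`(x, y, z) · (x', y', z') = (x + x', y + y', z + z' + (x y' - x' y) / 2)`; the identity is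
`(0, 0, 0)`.  The measure `volume` on it is the three-dimensional Lebesgue measure. -/
abbrev Heisenberg : Type := ℝ × ℝ × ℝ

/-- The left-invariant vector field `X = ∂_x - (y/2) ∂_z`. -/
def heisX (g : Heisenberg) : Heisenberg := (1, 0, -g.2.1 / 2)

/-- The left-invariant vector field `Y = ∂_y + (x/2) ∂_z`. -/
def heisY (g : Heisenberg) : Heisenberg := (0, 1, g.1 / 2)

/-- Horizontal curves: absolutely continuous on `[0,1]`, with velocity in `span {X, Y}` almost
everywhere.  Only the values of `γ` on `[0,1]` matter. -/
def IsHorizontal (γ : ℝ → Heisenberg) : Prop :=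
  AbsolutelyContinuousOnInterval γ 0 1 ∧
    ∀ᵐ t ∂(volume.restrict (Ioo (0 : ℝ) 1)),
      ∃ u₁ u₂ : ℝ, HasDerivAt γ (u₁ • heisX (γ t) + u₂ • heisY (γ t)) t

/-- The `ℓ^p`-length of a horizontal curve, `∫₀¹ ‖(u₁, u₂)‖_p dt`: for
`γ' = u₁ X + u₂ Y` the controls `u₁, u₂` are the first two coordinates of `γ'`. -/
def horizontalLength (p : ℝ≥0∞) (γ : ℝ → Heisenberg) : ℝ≥0∞ :=
  ∫⁻ t in Ioo (0 : ℝ) 1,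
    ENNReal.ofReal ‖WithLp.toLp p (((deriv γ t).1, (deriv γ t).2.1) : ℝ × ℝ)‖

/-- The `ℓ^p`-sub-Finsler distance of the Heisenberg group. -/
def heisDist (p : ℝ≥0∞) (g₀ g₁ : Heisenberg) : ℝ≥0∞ :=
  ⨅ (γ : ℝ → Heisenberg) (_ : IsHorizontal γ ∧ γ 0 = g₀ ∧ γ 1 = g₁), horizontalLength p γ

end

/-! Take p = 1 and let g be the endpoint of a staircase from the origin: a along `X`, b along `Y`, c
along `-X`, with a/b and c/b between 5/16 and 11/16. Such g fill open sets, yet every geodesic to g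
still has y = 0 at times t ≤ 1/8, so it lies in a null plane.

The reason is a calibration. Along a horizontal curve v = z - xy/2 satisfies dv = -y dx, so for
affine θ the integral of θ(y) dx depends only on the endpoints. If y has range [m, m + H], letting θ
fall from 1 to -1 there bounds the x-variation from below, while the y-variation is at least 2H - b.
For H = b the sum is a + b + c; widening the range costs 2(H - b) in y and saves at most (11/8)(H -
b) in x (`IsProfile.two_step_bound`). Cut the curve at q. If the first piece takes an eighth of the
length, it is too short to exhaust the edge a, so motion along `X` remains. Doing it above the
bottom, where θ < 1, loses length; so does climbing and coming back down. Hence q has y = 0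
(`IsProfile.abs_le_of_almost_minimal`).

A metric geodesic only supplies distances, which are infima, so the estimates concern almost minimal
pairs of curves with error ε; existence of minimising curves is never needed. A linear automorphism,
`heisRotate`, transfers the result to p = ∞. -/

/-! ### Variation of absolutely continuous functions -/

/-- Postcomposition with a Lipschitz map preserves absolute continuity. -/
lemma LipschitzWith.comp_absolutelyContinuousOnInterval {X Y : Type*} [PseudoMetricSpace X]
    [PseudoMetricSpace Y] {K : NNReal} {F : X → Y} (hF : LipschitzWith K F) {f : ℝ → X} {a b : ℝ}
    (hf : AbsolutelyContinuousOnInterval f a b) :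
    AbsolutelyContinuousOnInterval (fun t => F (f t)) a b := by
  unfold AbsolutelyContinuousOnInterval at *
  refine squeeze_zero (fun E => Finset.sum_nonneg fun _ _ => dist_nonneg) (fun E => ?_)
    (by simpa using hf.const_mul (K : ℝ))
  rw [Finset.mul_sum]
  exact Finset.sum_le_sum fun i _ => hF.dist_le_mul _ _

/-- The increment of an absolutely continuous function is bounded by the integral of the absolute
value of its derivative. -/
lemma AbsolutelyContinuousOnInterval.abs_sub_le_integral {f : ℝ → ℝ} {a b : ℝ} (hab : a ≤ b)
    (hf : AbsolutelyContinuousOnInterval f a b) :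
    |f b - f a| ≤ ∫ t in a..b, |deriv f t| := by
  rw [← hf.integral_deriv_eq_sub]
  exact intervalIntegral.abs_integral_le_integral_abs hab

/-- The total variation of an absolutely continuous function on an interval is at least twice the
length of its range minus the increment. -/
lemma AbsolutelyContinuousOnInterval.exists_range_bound {f : ℝ → ℝ}
    (hf : AbsolutelyContinuousOnInterval f 0 1) :
    ∃ m M : ℝ, (∀ t ∈ Icc (0 : ℝ) 1, f t ∈ Icc m M) ∧
      2 * (M - m) - |f 1 - f 0| ≤ ∫ t in (0 : ℝ)..1, |deriv f t| := by
  have hc : ContinuousOn f (Icc 0 1) := by simpa using hf.continuousOn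
  obtain ⟨s, hs, hms⟩ := isCompact_Icc.exists_isMinOn (nonempty_Icc.2 zero_le_one) hc
  obtain ⟨t, ht, hMt⟩ := isCompact_Icc.exists_isMaxOn (nonempty_Icc.2 zero_le_one) hc
  refine ⟨f s, f t, fun r hr => ⟨hms hr, hMt hr⟩, ?_⟩
  have sub : ∀ a ∈ Icc (0 : ℝ) 1, ∀ b ∈ Icc (0 : ℝ) 1,
      AbsolutelyContinuousOnInterval f a b := fun a ha b hb =>
    hf.mono (uIcc_subset_uIcc (by simpa using ha) (by simpa using hb))
  have key : ∀ a ∈ Icc (0 : ℝ) 1, ∀ b ∈ Icc (0 : ℝ) 1, a ≤ b →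
      |f a - f 0| + |f b - f a| + |f 1 - f b| ≤ ∫ t in (0 : ℝ)..1, |deriv f t| := by
    intro a ha b hb hab
    have h0 : (0 : ℝ) ∈ Icc (0 : ℝ) 1 := by simp
    have h1 : (1 : ℝ) ∈ Icc (0 : ℝ) 1 := by simp
    have i1 := (sub 0 h0 a ha).intervalIntegrable_deriv.abs
    have i2 := (sub a ha b hb).intervalIntegrable_deriv.abs
    have i3 := (sub b hb 1 h1).intervalIntegrable_deriv.abs
    rw [← intervalIntegral.integral_add_adjacent_intervals (i1.trans i2) i3,
      ← intervalIntegral.integral_add_adjacent_intervals i1 i2]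
    exact add_le_add (add_le_add ((sub 0 h0 a ha).abs_sub_le_integral ha.1)
      ((sub a ha b hb).abs_sub_le_integral hab)) ((sub b hb 1 h1).abs_sub_le_integral hb.2)
  rcases le_total s t with h | h
  · have := key s hs t ht h
    linarith [neg_abs_le (f s - f 0), le_abs_self (f t - f s), neg_abs_le (f 1 - f t),
      le_abs_self (f 1 - f 0)]
  · have := key t ht s hs h
    linarith [le_abs_self (f t - f 0), neg_abs_le (f s - f t), le_abs_self (f 1 - f s),
      neg_abs_le (f 1 - f 0)]

/-! ### Calibration of horizontal curves -/

/-- The vertical coordinate `v = z - x y / 2`, which satisfies `dv = -y dx` along horizontal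
curves. -/
noncomputable def heisV (g : Heisenberg) : ℝ := g.2.2 - g.1 * g.2.1 / 2

/-- Numerical data of a horizontal curve from `q₀` to `q₁`: the variations `U`, `V` of its first
two coordinates, and bounds `m`, `M` of its second coordinate.  The last field is the estimate
obtained by integrating `θ(y) dx` for an affine function `θ` with values in `[-1, κ]`. -/
structure IsProfile (q₀ q₁ : Heisenberg) (U V m M : ℝ) : Prop where
  left_mem : q₀.2.1 ∈ Icc m M
  right_mem : q₁.2.1 ∈ Icc m M
  abs_le : |q₁.1 - q₀.1| ≤ U
  range_le : 2 * (M - m) - |q₁.2.1 - q₀.2.1| ≤ V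
  affine_le : ∀ α β κ : ℝ, (∀ y ∈ Icc m M, -1 ≤ α - β * y ∧ α - β * y ≤ κ) →
    α * (q₁.1 - q₀.1) + β * (heisV q₁ - heisV q₀) + (1 - κ) * (U + (q₁.1 - q₀.1)) / 2 ≤ U

/-- Serves as a trivial first piece, so that the two-curve estimate also bounds a single curve. -/
lemma isProfile_refl : IsProfile (0, 0, 0) (0, 0, 0) 0 0 0 0 := by
  constructor <;> simp

namespace IsHorizontal

variable {γ : ℝ → Heisenberg}

lemma ac_fst (h : IsHorizontal γ) : AbsolutelyContinuousOnInterval (fun t => (γ t).1) 0 1 :=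
  LipschitzWith.prod_fst.comp_absolutelyContinuousOnInterval h.1

lemma ac_snd (h : IsHorizontal γ) : AbsolutelyContinuousOnInterval (fun t => (γ t).2.1) 0 1 :=
  LipschitzWith.prod_fst.comp_absolutelyContinuousOnInterval
    (LipschitzWith.prod_snd.comp_absolutelyContinuousOnInterval h.1)

lemma ac_heisV (h : IsHorizontal γ) :
    AbsolutelyContinuousOnInterval (fun t => heisV (γ t)) 0 1 := by
  have hz : AbsolutelyContinuousOnInterval (fun t => (γ t).2.2) 0 1 :=
    LipschitzWith.prod_snd.comp_absolutelyContinuousOnInterval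
      (LipschitzWith.prod_snd.comp_absolutelyContinuousOnInterval h.1)
  have e : (fun t => heisV (γ t)) =
      (fun t => (γ t).2.2) - fun t => 1 / 2 * ((γ t).1 * (γ t).2.1) :=
    funext fun t => by simp only [heisV, Pi.sub_apply]; ring
  rw [e]
  exact hz.sub ((h.ac_fst.mul h.ac_snd).const_mul (1 / 2))

lemma ae_deriv (h : IsHorizontal γ) : ∀ᵐ t ∂(volume.restrict (Ioo (0 : ℝ) 1)),
    (deriv γ t).1 = deriv (fun t => (γ t).1) t ∧
    (deriv γ t).2.1 = deriv (fun t => (γ t).2.1) t ∧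
    deriv (fun t => heisV (γ t)) t = -((γ t).2.1 * deriv (fun t => (γ t).1) t) := by
  filter_upwards [h.2] with t ⟨u₁, u₂, ht⟩
  have hx : HasDerivAt (fun t => (γ t).1) u₁ t := by
    refine ((ContinuousLinearMap.fst ℝ ℝ (ℝ × ℝ)).hasFDerivAt.comp_hasDerivAt t ht).congr_deriv ?_
    simp [heisX, heisY]
  have hy : HasDerivAt (fun t => (γ t).2.1) u₂ t := by
    refine (((ContinuousLinearMap.fst ℝ ℝ ℝ).comp
      (ContinuousLinearMap.snd ℝ ℝ (ℝ × ℝ))).hasFDerivAt.comp_hasDerivAt t ht).congr_deriv ?_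
    simp [heisX, heisY]
  have hz : HasDerivAt (fun t => (γ t).2.2) (u₁ * (-(γ t).2.1 / 2) + u₂ * ((γ t).1 / 2)) t := by
    refine (((ContinuousLinearMap.snd ℝ ℝ ℝ).comp
      (ContinuousLinearMap.snd ℝ ℝ (ℝ × ℝ))).hasFDerivAt.comp_hasDerivAt t ht).congr_deriv ?_
    simp [heisX, heisY]
  have hv : HasDerivAt (fun t => heisV (γ t)) (-((γ t).2.1 * u₁)) t := by
    refine (hz.sub ((hx.mul hy).div_const 2)).congr_deriv ?_
    ring
  rw [ht.deriv, hx.deriv, hy.deriv, hv.deriv]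
  simp [heisX, heisY]

/-- Every horizontal curve has a profile, whose total variation is its `ℓ¹`-length. -/
lemma exists_isProfile (h : IsHorizontal γ) :
    ∃ U V m M : ℝ, IsProfile (γ 0) (γ 1) U V m M ∧
      horizontalLength 1 γ = ENNReal.ofReal (U + V) := by
  obtain ⟨m, M, hmM, hV⟩ := h.ac_snd.exists_range_bound
  have iX : IntegrableOn (deriv fun t => (γ t).1) (Ioo 0 1) :=
    ((intervalIntegrable_iff_integrableOn_Ioo_of_le zero_le_one).1
      h.ac_fst.intervalIntegrable_deriv)
  have iY : IntegrableOn (deriv fun t => (γ t).2.1) (Ioo 0 1) :=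
    ((intervalIntegrable_iff_integrableOn_Ioo_of_le zero_le_one).1
      h.ac_snd.intervalIntegrable_deriv)
  have iV : IntegrableOn (deriv fun t => heisV (γ t)) (Ioo 0 1) :=
    ((intervalIntegrable_iff_integrableOn_Ioo_of_le zero_le_one).1
      h.ac_heisV.intervalIntegrable_deriv)
  have conv : ∀ f : ℝ → ℝ, ∫ t in (0 : ℝ)..1, f t = ∫ t in Ioo (0 : ℝ) 1, f t := fun f => by
    rw [intervalIntegral.integral_of_le zero_le_one, integral_Ioc_eq_integral_Ioo]
  refine ⟨∫ t in Ioo (0 : ℝ) 1, |deriv (fun t => (γ t).1) t|,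
    ∫ t in Ioo (0 : ℝ) 1, |deriv (fun t => (γ t).2.1) t|, m, M,
    ⟨hmM 0 (by simp), hmM 1 (by simp), ?_, by rw [← conv]; exact hV, ?_⟩, ?_⟩
  · rw [← conv]
    exact h.ac_fst.abs_sub_le_integral zero_le_one
  · intro α β κ hθ
    have eX := h.ac_fst.integral_deriv_eq_sub
    have eV := h.ac_heisV.integral_deriv_eq_sub
    rw [conv] at eX eV
    rw [← eX, ← eV, ← integral_add iX.abs iX, mul_div_assoc, ← integral_div,
      ← integral_const_mul, ← integral_const_mul, ← integral_const_mul, ← integral_add,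
      ← integral_add]
    · refine integral_mono_ae ?_ iX.abs ?_
      · exact ((iX.const_mul α).add (iV.const_mul β)).add
          (((iX.abs.add iX).div_const 2).const_mul (1 - κ))
      -- Pointwise, θu ≤ κu⁺ + u⁻ = |u| - (1 - κ)u⁺, with u⁺ = (|u| + u)/2.
      · filter_upwards [h.ae_deriv, ae_restrict_mem measurableSet_Ioo] with t ht htI
        obtain ⟨h1, h2⟩ := hθ _ (hmM t ⟨htI.1.le, htI.2.le⟩)
        simp only [ht.2.2]
        set u := deriv (fun t => (γ t).1) t
        rcases le_total 0 u with hu | hu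
        · rw [abs_of_nonneg hu]
          nlinarith
        · rw [abs_of_nonpos hu]
          nlinarith
    · exact (iX.const_mul α).add (iV.const_mul β)
    · exact ((iX.abs.add iX).div_const 2).const_mul (1 - κ)
    · exact iX.const_mul α
    · exact iV.const_mul β
  · rw [← integral_add iX.abs iY.abs]
    refine Eq.trans ?_ (ofReal_integral_eq_lintegral_ofReal (iX.abs.add iY.abs)
      (Filter.Eventually.of_forall fun t => add_nonneg (abs_nonneg _) (abs_nonneg _))).symm
    refine lintegral_congr_ae ?_
    filter_upwards [h.ae_deriv] with t ht
    rw [WithLp.prod_norm_eq_of_L1]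
    simp [ht.1, ht.2.1]

end IsHorizontal

lemma exists_isProfile_of_heisDist_lt {g₀ g₁ : Heisenberg} {L : ℝ}
    (h : heisDist 1 g₀ g₁ < ENNReal.ofReal L) :
    ∃ U V m M : ℝ, IsProfile g₀ g₁ U V m M ∧ U + V < L := by
  simp only [heisDist, iInf_lt_iff] at h
  obtain ⟨γ, ⟨hγ, rfl, rfl⟩, hL⟩ := h
  obtain ⟨U, V, m, M, hP, e⟩ := hγ.exists_isProfile
  rw [e] at hL
  exact ⟨U, V, m, M, hP, ((ENNReal.ofReal_lt_ofReal_iff').1 hL).1⟩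

/-! ### Length estimates for two consecutive curves -/

/-- The joint estimate for two consecutive horizontal curves from the origin to
`g = (a - c, b, b (a + c) / 2)`; here `[m, m + H]` is a common range of the second coordinate. -/
lemma IsProfile.two_step_bound {q : Heisenberg} {a b c U₁ V₁ m₁ M₁ U₂ V₂ m₂ M₂ : ℝ} (hb : 0 < b)
    (ha : a ≤ 11 / 16 * b) (hc : c ≤ 11 / 16 * b)
    (h₁ : IsProfile (0, 0, 0) q U₁ V₁ m₁ M₁)
    (h₂ : IsProfile q (a - c, b, b * (a + c) / 2) U₂ V₂ m₂ M₂) :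
    ∃ m H : ℝ, m ≤ m₁ ∧ m ≤ m₂ ∧ m ≤ 0 ∧ M₁ ≤ m + H ∧ M₂ ≤ m + H ∧ b ≤ m + H ∧
      2 * H - b ≤ V₁ + V₂ ∧ a + c - 11 / 8 * (H - b) ≤ U₁ + U₂ ∧
      a + c - 11 / 8 * (H - b) + (m₂ - m) / H * (U₂ + (a - c - q.1)) ≤ U₁ + U₂ := by
  have hl₁ : m₁ ≤ 0 ∧ 0 ≤ M₁ := h₁.left_mem
  have hr₁ : m₁ ≤ q.2.1 ∧ q.2.1 ≤ M₁ := h₁.right_mem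
  have hl₂ : m₂ ≤ q.2.1 ∧ q.2.1 ≤ M₂ := h₂.left_mem
  have hr₂ : m₂ ≤ b ∧ b ≤ M₂ := h₂.right_mem
  have hV₁ : 2 * (M₁ - m₁) - |q.2.1 - 0| ≤ V₁ := h₁.range_le
  have hV₂ : 2 * (M₂ - m₂) - |b - q.2.1| ≤ V₂ := h₂.range_le
  obtain ⟨m, hm⟩ : ∃ m, m = min m₁ m₂ := ⟨_, rfl⟩
  obtain ⟨M, hM⟩ : ∃ M, M = max M₁ M₂ := ⟨_, rfl⟩
  obtain ⟨H, hH⟩ : ∃ H, H = M - m := ⟨_, rfl⟩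
  have hm₁ : m ≤ m₁ := hm ▸ min_le_left _ _
  have hm₂ : m ≤ m₂ := hm ▸ min_le_right _ _
  have hM₁ : M₁ ≤ M := hM ▸ le_max_left _ _
  have hM₂ : M₂ ≤ M := hM ▸ le_max_right _ _
  have hV : 2 * H - b ≤ V₁ + V₂ := by grind
  have hm0 : m ≤ 0 := by linarith
  have hbM : b ≤ M := by linarith
  have hHb : b ≤ H := by linarith
  have hH0 : 0 < H := by linarith
  -- The calibration is θ(y) = 1 - 2τ(y - m), equal to 1 at the bottom m and to -1 at the top M.
  obtain ⟨τ, hτ⟩ : ∃ τ, τ = 1 / H := ⟨_, rfl⟩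
  have hτ0 : 0 < τ := hτ ▸ by positivity
  have hτH : τ * H = 1 := by rw [hτ]; field_simp
  have hup : ∀ y, y ≤ M → τ * y - τ * m ≤ 1 := fun y hy => by
    rw [← hτH, ← mul_sub]
    exact mul_le_mul_of_nonneg_left (by linarith) hτ0.le
  have hlow : ∀ μ y, μ ≤ y → τ * μ ≤ τ * y := fun μ y h => mul_le_mul_of_nonneg_left h hτ0.le
  -- Since b - H ≤ m ≤ 0, the deficit from a + c is at most 2 max(a, c)(H - b)/H, and b ≤ H.
  have hmain : a + c - 11 / 8 * (H - b) ≤ (1 + 2 * τ * m) * (a - c) + 2 * τ * (b * c) := by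
    have h1 : -(11 / 16 * b * (H - b)) ≤ m * (a - c) - c * (H - b) := by
      rcases le_total c a with hca | hca
      · have := mul_le_mul_of_nonneg_right (show b - H ≤ m by linarith) (sub_nonneg.2 hca)
        have := mul_le_mul_of_nonneg_right ha (sub_nonneg.2 hHb)
        linarith
      · have := mul_nonneg_of_nonpos_of_nonpos hm0 (sub_nonpos.2 hca)
        have := mul_le_mul_of_nonneg_right hc (sub_nonneg.2 hHb)
        linarith
    have h2 : b * (H - b) ≤ H * (H - b) := mul_le_mul_of_nonneg_right hHb (sub_nonneg.2 hHb)
    have h3 : 0 ≤ τ * (m * (a - c) - c * (H - b) + 11 / 16 * (H * (H - b))) :=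
      mul_nonneg hτ0.le (by linarith)
    have h4 : τ * (m * (a - c) - c * (H - b) + 11 / 16 * (H * (H - b))) =
      τ * m * (a - c) + τ * (b * c) - (τ * H) * c + 11 / 16 * (τ * H) * (H - b) := by ring
    rw [h4, hτH] at h3
    linarith
  -- The same θ serves both curves, but on the second one y ≥ μ improves the upper bound of θ from 1
  -- to 1 - 2τ(μ - m). Taking μ = m gives the plain estimate, μ = m₂ the refined one.
  have key : ∀ μ, μ ≤ m₂ → a + c - 11 / 8 * (H - b) + τ * (μ - m) * (U₂ + (a - c - q.1)) ≤
      U₁ + U₂ := by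
    intro μ hμ
    have e₁ := h₁.affine_le (1 + 2 * τ * m) (2 * τ) 1 fun y hy =>
      ⟨by linarith [hup y (by linarith [hy.2])], by linarith [hlow m y (by linarith [hy.1])]⟩
    have e₂ := h₂.affine_le (1 + 2 * τ * m) (2 * τ) (1 - 2 * τ * (μ - m)) fun y hy =>
      ⟨by linarith [hup y (by linarith [hy.2])], by linarith [hlow μ y (by linarith [hy.1])]⟩
    have hv : heisV (a - c, b, b * (a + c) / 2) = b * c := by simp only [heisV]; ring
    have hv0 : heisV (0, 0, 0) = 0 := by simp [heisV]
    rw [hv] at e₂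
    rw [hv0] at e₁
    simp only at e₁ e₂
    linarith
  refine ⟨m, H, hm₁, hm₂, by linarith, by linarith, by linarith, by linarith, hV, ?_, ?_⟩
  · simpa using key m hm₂
  · have := key m₂ le_rfl
    rw [hτ] at this
    convert this using 2
    ring

/-- Two consecutive horizontal curves from the origin to `g` have total length at least
`a + b + c`. -/
lemma IsProfile.add_le {q : Heisenberg} {a b c U₁ V₁ m₁ M₁ U₂ V₂ m₂ M₂ : ℝ} (hb : 0 < b)
    (ha : a ≤ 11 / 16 * b) (hc : c ≤ 11 / 16 * b)
    (h₁ : IsProfile (0, 0, 0) q U₁ V₁ m₁ M₁)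
    (h₂ : IsProfile q (a - c, b, b * (a + c) / 2) U₂ V₂ m₂ M₂) :
    a + b + c ≤ U₁ + V₁ + (U₂ + V₂) := by
  obtain ⟨m, H, -, -, hm0, -, -, hb', hV, hU, -⟩ := two_step_bound hb ha hc h₁ h₂
  linarith

/-- If two consecutive horizontal curves from the origin to `g` have almost minimal total length
and the first one has length at most about `(a + b + c) / 8`, then it almost does not move in the
direction of `y`. -/
lemma IsProfile.abs_le_of_almost_minimal {q : Heisenberg}
    {a b c U₁ V₁ m₁ M₁ U₂ V₂ m₂ M₂ ε : ℝ} (hb : 0 < b)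
    (ha0 : 5 / 16 * b ≤ a) (ha : a ≤ 11 / 16 * b) (hc : c ≤ 11 / 16 * b)
    (h₁ : IsProfile (0, 0, 0) q U₁ V₁ m₁ M₁)
    (h₂ : IsProfile q (a - c, b, b * (a + c) / 2) U₂ V₂ m₂ M₂)
    (hε : 0 < ε) (hεb : 400 * ε ≤ b) (hL₁ : U₁ + V₁ ≤ (a + b + c) / 8 + ε)
    (hL : U₁ + V₁ + (U₂ + V₂) ≤ a + b + c + ε) : |q.2.1| ≤ 200 * ε := by
  obtain ⟨m, H, hm₁, hm₂, hm0, hM₁, hM₂, hb', hV, hU, hE⟩ :=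
    two_step_bound hb ha hc h₁ h₂
  have hr₁ : m₁ ≤ q.2.1 ∧ q.2.1 ≤ M₁ := h₁.right_mem
  have hl₂ : m₂ ≤ q.2.1 ∧ q.2.1 ≤ M₂ := h₂.left_mem
  have hl₁ : m₁ ≤ 0 ∧ 0 ≤ M₁ := h₁.left_mem
  have hr₂ : m₂ ≤ b ∧ b ≤ M₂ := h₂.right_mem
  have hV₁ : 2 * (M₁ - m₁) - |q.2.1 - 0| ≤ V₁ := h₁.range_le
  have hV₂ : 2 * (M₂ - m₂) - |b - q.2.1| ≤ V₂ := h₂.range_le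
  have hx : |q.1 - 0| ≤ U₁ := h₁.abs_le
  have hHb : H - b ≤ 8 / 5 * ε := by linarith
  -- Below zero, m ≤ y and b ≤ m + H already give |y| ≤ H - b.
  rcases le_or_gt q.2.1 0 with hq | hq
  · rw [abs_of_nonpos hq]
    linarith
  rw [abs_of_pos hq]
  by_contra! hcon
  obtain ⟨μ, hμ⟩ : ∃ μ, μ = min q.2.1 b := ⟨_, rfl⟩
  have hμε : 200 * ε < μ := by rw [hμ]; exact lt_min hcon (by linarith)
  -- Otherwise the second coordinate climbs to that of q, descends to m₂ and climbs to b, wasting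
  -- more than μ of variation.
  have hm₂μ : μ / 2 ≤ m₂ := by
    by_contra! hlt
    have hμq : μ ≤ q.2.1 := hμ ▸ min_le_left _ _
    have : 2 * q.2.1 + b - 2 * m₂ ≤ V₁ + V₂ := by grind
    linarith
  have hH0 : 0 < H := by linarith
  -- The left-over motion along `X`, counted twice: up to multiples of ε it is at least 2(a - (a + b
  -- + c)/8) ≥ b/8.
  have hW : b / 32 ≤ U₂ + (a - c - q.1) := by
    have := le_abs_self (q.1 - 0)
    have hV₁0 : 0 ≤ V₁ := by grind
    linarith
  have hμ0 : 0 < μ := by linarith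
  have hfrac : μ / (4 * b) ≤ (m₂ - m) / H := by
    rw [div_le_div_iff₀ (by positivity) hH0]
    nlinarith
  -- The surplus is at least μ/128 > 200ε/128 > ε, which exceeds the allowed error.
  have h1 : μ / (4 * b) * (b / 32) ≤ (m₂ - m) / H * (U₂ + (a - c - q.1)) :=
    mul_le_mul hfrac hW (by positivity) (le_trans (by positivity) hfrac)
  have h2 : μ / (4 * b) * (b / 32) = μ / 128 := by
    rw [div_mul_div_comm, mul_comm μ b, mul_comm 4 b, mul_assoc,
      mul_div_mul_left _ _ hb.ne']
    norm_num
  linarith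

/-! ### Staircases and the exact distance -/

lemma AbsolutelyContinuousOnInterval.prodMk {X Y : Type*} [PseudoMetricSpace X]
    [PseudoMetricSpace Y] {f : ℝ → X} {g : ℝ → Y} {a b : ℝ}
    (hf : AbsolutelyContinuousOnInterval f a b) (hg : AbsolutelyContinuousOnInterval g a b) :
    AbsolutelyContinuousOnInterval (fun t => (f t, g t)) a b := by
  unfold AbsolutelyContinuousOnInterval at *
  refine squeeze_zero (fun E => Finset.sum_nonneg fun _ _ => dist_nonneg) (fun E => ?_)
    (by simpa using hf.add hg)
  rw [← Finset.sum_add_distrib]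
  exact Finset.sum_le_sum fun i _ => max_le_add_of_nonneg dist_nonneg dist_nonneg

/-- The staircase curve moving by `a` along `X`, by `b` along `Y` and by `c` along `-X`, with
constant speed `D`. -/
noncomputable def staircase (a b D t : ℝ) : Heisenberg :=
  (min (D * t) a - max (D * t - (a + b)) 0, min (max (D * t - a) 0) b,
    -- Horizontality gives d(z + xy/2) = x dy, and y moves only while x = a; hence z = ay - xy/2.
    a * min (max (D * t - a) 0) b -
      1 / 2 * ((min (D * t) a - max (D * t - (a + b)) 0) * min (max (D * t - a) 0) b))

lemma staircase_ac (a b D : ℝ) : AbsolutelyContinuousOnInterval (staircase a b D) 0 1 := by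
  have hlin : ∀ e : ℝ, LipschitzWith ‖D‖₊ fun t => D * t - e := fun e =>
    LipschitzWith.of_dist_le_mul fun s t => by
      simp [Real.dist_eq, ← mul_sub, abs_mul]
  have hlin' : LipschitzWith ‖D‖₊ fun t => D * t := by simpa using hlin 0
  have hx := ((hlin'.min_const a).lipschitzOnWith (s := uIcc 0 1)).absolutelyContinuousOnInterval.sub
    (((hlin (a + b)).max_const 0).lipschitzOnWith (s := uIcc 0 1)).absolutelyContinuousOnInterval
  have hy := ((((hlin a).max_const 0).min_const b).lipschitzOnWith
    (s := uIcc 0 1)).absolutelyContinuousOnInterval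
  exact hx.prodMk (hy.prodMk ((hy.const_mul a).sub ((hx.mul hy).const_mul (1 / 2))))

lemma staircase_hasDerivAt {a b D t : ℝ} (hb : 0 < b) (hD : 0 ≤ D)
    (h₁ : D * t ≠ a) (h₂ : D * t ≠ a + b) :
    ∃ u₁ u₂ : ℝ, HasDerivAt (staircase a b D)
      (u₁ • heisX (staircase a b D t) + u₂ • heisY (staircase a b D t)) t ∧ |u₁| + |u₂| = D := by
  have hlin : HasDerivAt (fun s => D * s) D t := by simpa using (hasDerivAt_id t).const_mul D
  have hcont : Filter.Tendsto (fun s => D * s) (nhds t) (nhds (D * t)) := hlin.continuousAt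
  have val : ∀ {f : ℝ → Heisenberg} {f' : Heisenberg} {u₁ u₂ : ℝ},
      (∀ᶠ s in nhds t, staircase a b D s = f s) → HasDerivAt f f' t →
      f' = u₁ • heisX (f t) + u₂ • heisY (f t) →
      HasDerivAt (staircase a b D)
        (u₁ • heisX (staircase a b D t) + u₂ • heisY (staircase a b D t)) t := by
    intro f f' u₁ u₂ he hf e
    rw [he.self_of_nhds, ← e]
    exact hf.congr_of_eventuallyEq he
  rcases lt_or_gt_of_ne h₁ with h | h
  · refine ⟨D, 0, val (f := fun s => (D * s, 0, 0)) ?_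
      (hlin.prodMk ((hasDerivAt_const t 0).prodMk (hasDerivAt_const t 0))) ?_, by simpa using hD⟩
    · filter_upwards [hcont.eventually (gt_mem_nhds h)] with s hs
      rw [staircase, min_eq_left hs.le, max_eq_right (by linarith : D * s - (a + b) ≤ 0),
        max_eq_right (by linarith : D * s - a ≤ 0), min_eq_left hb.le]
      simp
    · simp [heisX, heisY]
  rcases lt_or_gt_of_ne h₂ with h' | h'
  · refine ⟨0, D, val (f := fun s => (a, D * s - a, a / 2 * (D * s - a))) ?_
      ((hasDerivAt_const t a).prodMk ((hlin.sub_const a).prodMk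
        ((hlin.sub_const a).const_mul (a / 2)))) ?_, by simpa using hD⟩
    · filter_upwards [hcont.eventually (lt_mem_nhds h), hcont.eventually (gt_mem_nhds h')]
        with s hs hs'
      rw [staircase, min_eq_right hs.le, max_eq_right (by linarith : D * s - (a + b) ≤ 0),
        max_eq_left (by linarith : 0 ≤ D * s - a), min_eq_left (by linarith : D * s - a ≤ b)]
      ext <;> simp
      ring
    · simp [heisX, heisY, mul_comm]
  · refine ⟨-D, 0, val (f := fun s => (a - (D * s - (a + b)), b,
        a * b - b / 2 * (a - (D * s - (a + b))))) ?_
      (((hlin.sub_const (a + b)).const_sub a).prodMk ((hasDerivAt_const t b).prodMk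
        ((((hlin.sub_const (a + b)).const_sub a).const_mul (b / 2)).const_sub (a * b)))) ?_,
        by simpa using hD⟩
    · filter_upwards [hcont.eventually (lt_mem_nhds h), hcont.eventually (lt_mem_nhds h')]
        with s hs hs'
      rw [staircase, min_eq_right hs.le, max_eq_left (by linarith : 0 ≤ D * s - (a + b)),
        max_eq_left (by linarith : 0 ≤ D * s - a), min_eq_right (by linarith : b ≤ D * s - a)]
      ext <;> simp
      ring
    · ext <;> simp [heisX, heisY]
      ring

lemma heisDist_one_le {a b c : ℝ} (ha : 0 ≤ a) (hb : 0 < b) (hc : 0 ≤ c) :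
    heisDist 1 (0, 0, 0) (a - c, b, b * (a + c) / 2) ≤ ENNReal.ofReal (a + b + c) := by
  obtain ⟨D, hD⟩ : ∃ D, D = a + b + c := ⟨_, rfl⟩
  have hD0 : 0 < D := by linarith
  rw [← hD]
  have hae : ∀ᵐ t ∂(volume.restrict (Ioo (0 : ℝ) 1)), D * t ≠ a ∧ D * t ≠ a + b := by
    refine ae_restrict_of_ae ?_
    filter_upwards [Measure.ae_ne volume (a / D), Measure.ae_ne volume ((a + b) / D)] with t h h'
    refine ⟨fun e => h ?_, fun e => h' ?_⟩ <;> rw [← e] <;> field_simp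
  have hder := hae.mono fun t ht => staircase_hasDerivAt hb hD0.le ht.1 ht.2
  have h0 : staircase a b D 0 = (0, 0, 0) := by
    rw [staircase, mul_zero, min_eq_left ha, max_eq_right (by linarith), max_eq_right (by linarith),
      min_eq_left hb.le]
    simp
  have h1 : staircase a b D 1 = (a - c, b, b * (a + c) / 2) := by
    rw [staircase, mul_one, min_eq_right (by linarith), max_eq_left (by linarith),
      max_eq_left (by linarith), min_eq_right (by linarith)]
    ext <;> simp only [hD] <;> ring
  have hlen : horizontalLength 1 (staircase a b D) = ENNReal.ofReal D := by
    rw [horizontalLength]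
    calc _ = ∫⁻ _ in Ioo (0 : ℝ) 1, ENNReal.ofReal D := by
          refine lintegral_congr_ae (hder.mono fun t ⟨u₁, u₂, h, hu⟩ => ?_)
          simp only
          rw [h.deriv, WithLp.prod_norm_eq_of_L1, ← hu]
          simp [heisX, heisY]
      _ = _ := by simp
  rw [← hlen]
  exact iInf₂_le (staircase a b D)
    ⟨⟨staircase_ac a b D, hder.mono fun t ⟨u₁, u₂, h, _⟩ => ⟨u₁, u₂, h⟩⟩, h0, h1⟩

/-- The staircase gives the upper bound; the lower one is the two-curve estimate with a constant
first curve. -/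
lemma heisDist_one_eq {a b c : ℝ} (ha : 0 ≤ a) (ha' : a ≤ 11 / 16 * b) (hb : 0 < b) (hc : 0 ≤ c)
    (hc' : c ≤ 11 / 16 * b) :
    heisDist 1 (0, 0, 0) (a - c, b, b * (a + c) / 2) = ENNReal.ofReal (a + b + c) := by
  refine (heisDist_one_le ha hb hc).antisymm (not_lt.1 fun h => ?_)
  obtain ⟨U, V, m, M, hP, hL⟩ := exists_isProfile_of_heisDist_lt h
  linarith [isProfile_refl.add_le hb ha' hc' hP]

/-- The endpoints of geodesics from the origin with three edges, the first of which is at least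
an eighth of the length, are reached by geodesics which do not move in the `y`-direction before
time `1 / 8`. -/
lemma IsMinGeodesic.snd_eq_zero {γ : unitInterval → Heisenberg} (hγ : IsMinGeodesic (heisDist 1) γ)
    {a b c : ℝ} (ha : 5 / 16 * b ≤ a) (ha' : a ≤ 11 / 16 * b) (hb : 0 < b) (hc : 0 ≤ c)
    (hc' : c ≤ 11 / 16 * b) (h0 : γ 0 = (0, 0, 0)) (h1 : γ 1 = (a - c, b, b * (a + c) / 2))
    {t : unitInterval} (ht : (t : ℝ) ≤ 1 / 8) : (γ t).2.1 = 0 := by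
  have hd : heisDist 1 (γ 0) (γ 1) = ENNReal.ofReal (a + b + c) := by
    rw [h0, h1, heisDist_one_eq (by linarith) ha' hb hc hc']
  have hD : 0 < a + b + c := by linarith
  by_contra hne
  have hpos := abs_pos.2 hne
  -- Chosen so that the bound |y| ≤ 200ε would force |y| ≤ |y|/2.
  obtain ⟨ε, hε⟩ : ∃ ε, ε = min (b / 400) (|(γ t).2.1| / 400) := ⟨_, rfl⟩
  have hε0 : 0 < ε := hε ▸ lt_min (by positivity) (by positivity)
  have hεb : ε ≤ b / 400 := hε ▸ min_le_left _ _
  have hεq : ε ≤ |(γ t).2.1| / 400 := hε ▸ min_le_right _ _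
  have htD : (t : ℝ) * (a + b + c) ≤ 1 / 8 * (a + b + c) :=
    mul_le_mul_of_nonneg_right ht hD.le
  have ht0 : 0 ≤ (t : ℝ) * (a + b + c) := mul_nonneg t.2.1 hD.le
  have l₁ : heisDist 1 (0, 0, 0) (γ t) < ENNReal.ofReal (t * (a + b + c) + ε / 2) := by
    rw [← h0, hγ.2 0 t, hd, ← ENNReal.ofReal_mul (abs_nonneg _)]
    refine (ENNReal.ofReal_lt_ofReal_iff (by positivity)).2 ?_
    simp only [Icc.coe_zero, sub_zero, abs_of_nonneg t.2.1]
    linarith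
  have l₂ : heisDist 1 (γ t) (a - c, b, b * (a + c) / 2) <
      ENNReal.ofReal ((1 - t) * (a + b + c) + ε / 2) := by
    have h1t : 0 ≤ 1 - (t : ℝ) := sub_nonneg.2 t.2.2
    rw [← h1, hγ.2 t 1, hd, ← ENNReal.ofReal_mul (abs_nonneg _)]
    refine (ENNReal.ofReal_lt_ofReal_iff (by positivity)).2 ?_
    simp only [Icc.coe_one, abs_of_nonneg h1t]
    linarith
  obtain ⟨U₁, V₁, m₁, M₁, hP₁, hL₁⟩ := exists_isProfile_of_heisDist_lt l₁
  obtain ⟨U₂, V₂, m₂, M₂, hP₂, hL₂⟩ := exists_isProfile_of_heisDist_lt l₂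
  have := hP₁.abs_le_of_almost_minimal hb ha ha' hc' hP₂ hε0 (by linarith) (by linarith)
    (by linarith)
  linarith

/-! ### From the `ℓ¹`- to the `ℓ^∞`-distance -/

/-- A linear map which maps horizontal vectors to horizontal vectors and preserves the norms of the
controls does not increase distances. -/
lemma heisDist_map_le (φ : Heisenberg →L[ℝ] Heisenberg) {p p' : ℝ≥0∞}
    (hφ : ∀ g u₁ u₂, ∃ v₁ v₂,
      φ (u₁ • heisX g + u₂ • heisY g) = v₁ • heisX (φ g) + v₂ • heisY (φ g) ∧
      ‖WithLp.toLp p' ((v₁, v₂) : ℝ × ℝ)‖ = ‖WithLp.toLp p ((u₁, u₂) : ℝ × ℝ)‖)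
    (g h : Heisenberg) : heisDist p' (φ g) (φ h) ≤ heisDist p g h := by
  refine le_iInf₂ fun γ ⟨hγ, h0, h1⟩ => ?_
  have hae : ∀ᵐ t ∂(volume.restrict (Ioo (0 : ℝ) 1)), ∃ u₁ u₂ v₁ v₂ : ℝ,
      HasDerivAt γ (u₁ • heisX (γ t) + u₂ • heisY (γ t)) t ∧
      HasDerivAt (fun t => φ (γ t)) (v₁ • heisX (φ (γ t)) + v₂ • heisY (φ (γ t))) t ∧
      ‖WithLp.toLp p' ((v₁, v₂) : ℝ × ℝ)‖ = ‖WithLp.toLp p ((u₁, u₂) : ℝ × ℝ)‖ := by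
    filter_upwards [hγ.2] with t ⟨u₁, u₂, ht⟩
    obtain ⟨v₁, v₂, hv, hn⟩ := hφ (γ t) u₁ u₂
    exact ⟨u₁, u₂, v₁, v₂, ht, hv ▸ φ.hasFDerivAt.comp_hasDerivAt t ht, hn⟩
  have hlen : horizontalLength p' (fun t => φ (γ t)) = horizontalLength p γ := by
    refine lintegral_congr_ae (hae.mono fun t ⟨u₁, u₂, v₁, v₂, h, h', hn⟩ => ?_)
    simp only
    rw [h.deriv, h'.deriv]
    simpa [heisX, heisY] using congrArg ENNReal.ofReal hn
  rw [← hlen]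
  exact iInf₂_le (fun t => φ (γ t)) ⟨⟨φ.lipschitz.comp_absolutelyContinuousOnInterval hγ.1,
    hae.mono fun t ⟨_, _, v₁, v₂, _, h', _⟩ => ⟨v₁, v₂, h'⟩⟩, by simp only [h0], by simp only [h1]⟩

/-- The automorphism of the Heisenberg group carrying the `ℓ^∞`-distance to the
`ℓ¹`-distance. -/
noncomputable def heisRotate : Heisenberg ≃L[ℝ] Heisenberg :=
  LinearEquiv.toContinuousLinearEquiv
    { toFun := fun g => ((g.1 + g.2.1) / 2, (g.2.1 - g.1) / 2, g.2.2 / 2)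
      invFun := fun g => (g.1 - g.2.1, g.1 + g.2.1, 2 * g.2.2)
      map_add' := fun g h => by ext <;> simp <;> ring
      map_smul' := fun c g => by ext <;> simp <;> ring
      left_inv := fun g => by ext <;> simp <;> ring
      right_inv := fun g => by ext <;> simp }

lemma heisRotate_apply (g : Heisenberg) :
    heisRotate g = ((g.1 + g.2.1) / 2, (g.2.1 - g.1) / 2, g.2.2 / 2) := rfl

lemma heisRotate_symm_apply (g : Heisenberg) :
    heisRotate.symm g = (g.1 - g.2.1, g.1 + g.2.1, 2 * g.2.2) := rfl

lemma heisDist_heisRotate (g h : Heisenberg) :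
    heisDist 1 (heisRotate g) (heisRotate h) = heisDist ∞ g h := by
  refine le_antisymm (heisDist_map_le (heisRotate : Heisenberg →L[ℝ] Heisenberg) ?_ g h) ?_
  · intro g u₁ u₂
    refine ⟨(u₁ + u₂) / 2, (u₂ - u₁) / 2, ?_, ?_⟩
    · simp only [ContinuousLinearEquiv.coe_coe, heisRotate_apply]
      ext <;> simp [heisX, heisY]
      ring
    · rw [WithLp.prod_norm_eq_of_L1, WithLp.prod_norm_eq_sup]
      change |(u₁ + u₂) / 2| + |(u₂ - u₁) / 2| = max |u₁| |u₂|
      grind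
  · have := heisDist_map_le (p := 1) (p' := ∞) (heisRotate.symm : Heisenberg →L[ℝ] Heisenberg) ?_
      (heisRotate g) (heisRotate h)
    · simpa using this
    intro g u₁ u₂
    refine ⟨u₁ - u₂, u₁ + u₂, ?_, ?_⟩
    · simp only [ContinuousLinearEquiv.coe_coe, heisRotate_symm_apply]
      ext <;> simp [heisX, heisY]
      ring
    · rw [WithLp.prod_norm_eq_of_L1, WithLp.prod_norm_eq_sup]
      change max |u₁ - u₂| |u₁ + u₂| = |u₁| + |u₂|
      grind

/-! ### Open sets with collapsing geodesics -/

/-- At every scale there is an open set, on which the distance from the origin is given by a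
measurable function, such that all geodesics from the origin to it stay in a fixed plane up to
time `1 / 8`. -/
noncomputable def HasCollapsingGeodesics (d : Heisenberg → Heisenberg → ℝ≥0∞) : Prop :=
  ∃ l : Heisenberg →ₗ[ℝ] ℝ, l ≠ 0 ∧ ∀ r > 0, ∃ (Ω : Set Heisenberg) (D : Heisenberg → ℝ),
    IsOpen Ω ∧ Ω.Nonempty ∧ Bornology.IsBounded Ω ∧ Measurable D ∧
    (∀ g ∈ Ω, 0 < D g ∧ D g < r ∧ d (0, 0, 0) g = ENNReal.ofReal (D g)) ∧
    ∀ γ, IsMinGeodesic d γ → γ 0 = (0, 0, 0) → γ 1 ∈ Ω →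
      ∀ t : unitInterval, (t : ℝ) ≤ 1 / 8 → l (γ t) = 0

lemma HasCollapsingGeodesics.comp {d d' : Heisenberg → Heisenberg → ℝ≥0∞}
    (h : HasCollapsingGeodesics d) (φ : Heisenberg ≃L[ℝ] Heisenberg)
    (hφ : ∀ g g', d (φ g) (φ g') = d' g g') : HasCollapsingGeodesics d' := by
  obtain ⟨l, hl, h⟩ := h
  have hφ0 : φ (0, 0, 0) = (0, 0, 0) := φ.map_zero
  refine ⟨l ∘ₗ (φ : Heisenberg →ₗ[ℝ] Heisenberg), fun h0 => hl ?_, fun r hr => ?_⟩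
  · exact LinearMap.ext fun g => by simpa using LinearMap.congr_fun h0 (φ.symm g)
  · obtain ⟨Ω, D, hΩ, hne, hbd, hD, hdist, hgeo⟩ := h r hr
    refine ⟨φ ⁻¹' Ω, fun g => D (φ g), hΩ.preimage φ.continuous, hne.preimage φ.surjective, ?_,
      hD.comp φ.continuous.measurable, fun g hg => ?_, fun γ hγ h0 h1 t ht => ?_⟩
    · exact φ.antilipschitz.isBounded_preimage hbd
    · rw [← hφ, hφ0]
      exact hdist (φ g) hg
    · refine hgeo (fun t => φ (γ t)) ⟨?_, fun s t => ?_⟩ (by simp only [h0, hφ0]) h1 t ht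
      · simpa only [hφ] using hγ.1
      · simpa only [hφ] using hγ.2 s t

lemma hasCollapsingGeodesics_one : HasCollapsingGeodesics (heisDist 1) := by
  refine ⟨LinearMap.fst ℝ ℝ ℝ ∘ₗ LinearMap.snd ℝ ℝ (ℝ × ℝ), fun h => ?_, fun r hr => ?_⟩
  · simpa using LinearMap.congr_fun h (0, 1, 0)
  -- Here a = z/y + x/2, b = y, c = z/y - x/2. The bounds place a/b and c/b in (5/16, 11/16), and a
  -- + b + c = y + 2z/y < (9/4)(2r/5) < r.
  refine ⟨{g | |g.1| < g.2.1 / 8 ∧ r / 5 < g.2.1 ∧ g.2.1 < 2 * r / 5 ∧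
    3 / 8 * g.2.1 ^ 2 < g.2.2 ∧ g.2.2 < 5 / 8 * g.2.1 ^ 2}, fun g => g.2.1 + 2 * (g.2.2 / g.2.1),
    ?_, ?_, ?_, by fun_prop, ?_, ?_⟩
  · exact (isOpen_lt (by fun_prop) (by fun_prop)).and ((isOpen_lt (by fun_prop) (by fun_prop)).and
      ((isOpen_lt (by fun_prop) (by fun_prop)).and ((isOpen_lt (by fun_prop) (by fun_prop)).and
      (isOpen_lt (by fun_prop) (by fun_prop)))))
  · refine ⟨(0, 3 / 10 * r, 1 / 2 * (3 / 10 * r) ^ 2), ?_, ?_, ?_, ?_, ?_⟩ <;> simp <;> nlinarith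
  · refine (Metric.isBounded_Icc ((-r, 0, 0) : Heisenberg) (r, r, r ^ 2)).subset ?_
    rintro ⟨x, y, z⟩ ⟨h1, h2, h3, h4, h5⟩
    simp only at h1 h2 h3 h4 h5
    obtain ⟨h1, h1'⟩ := abs_lt.1 h1
    refine ⟨⟨?_, ?_, ?_⟩, ⟨?_, ?_, ?_⟩⟩ <;> simp only <;> nlinarith
  all_goals
    have key : ∀ g : Heisenberg, |g.1| < g.2.1 / 8 → r / 5 < g.2.1 → 3 / 8 * g.2.1 ^ 2 < g.2.2 →
        g.2.2 < 5 / 8 * g.2.1 ^ 2 → ∃ a b c : ℝ, 0 < b ∧ 5 / 16 * b < a ∧ a < 11 / 16 * b ∧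
          5 / 16 * b < c ∧ c < 11 / 16 * b ∧ g = (a - c, b, b * (a + c) / 2) := by
      rintro ⟨x, y, z⟩ h1 h2 h4 h5
      simp only at h1 h2 h4 h5
      obtain ⟨h1, h1'⟩ := abs_lt.1 h1
      have hy : 0 < y := by linarith
      have hz : 3 / 8 * y < z / y := by rw [lt_div_iff₀ hy]; linarith
      have hz' : z / y < 5 / 8 * y := by rw [div_lt_iff₀ hy]; linarith
      refine ⟨z / y + x / 2, y, z / y - x / 2, hy, by linarith, by linarith, by linarith,
        by linarith, ?_⟩
      ext <;> simp only
      · ring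
      · field_simp
        ring
  · rintro g ⟨h1, h2, h3, h4, h5⟩
    obtain ⟨a, b, c, hb, ha, ha', hc, hc', rfl⟩ := key g h1 h2 h4 h5
    simp only at h2 h3 ⊢
    have e : b + 2 * (b * (a + c) / 2 / b) = a + b + c := by field_simp; ring
    rw [e, heisDist_one_eq (by linarith) ha'.le hb (by linarith) hc'.le]
    exact ⟨by linarith, by linarith, rfl⟩
  · rintro γ hγ h0 ⟨h1, h2, h3, h4, h5⟩ t ht
    obtain ⟨a, b, c, hb, ha, ha', hc, hc', e⟩ := key _ h1 h2 h4 h5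
    exact hγ.snd_eq_zero ha.le ha'.le hb (by linarith) hc'.le h0 e ht

lemma hasCollapsingGeodesics_heisDist {p : ℝ≥0∞} (hp : p = 1 ∨ p = ∞) :
    HasCollapsingGeodesics (heisDist p) := by
  rcases hp with rfl | rfl
  · exact hasCollapsingGeodesics_one
  · exact hasCollapsingGeodesics_one.comp heisRotate heisDist_heisRotate

/-! ### Failure of the measure contraction property -/

lemma measurable_genSin (K : ℝ) : Measurable (genSin K) := by
  unfold genSin
  split_ifs
  · fun_prop
  · exact measurable_id
  · exact (Real.measurable_sinh.comp (measurable_const.mul measurable_id)).div_const _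

lemma genSin_pos {K r : ℝ} (hr : 0 < r) (h : 0 < K → √K * r < Real.pi) : 0 < genSin K r := by
  unfold genSin
  split_ifs with h1 h2
  · exact div_pos (Real.sin_pos_of_pos_of_lt_pi (by positivity) (h h1)) (by positivity)
  · exact hr
  · have : 0 < -K := neg_pos.2 (lt_of_le_of_ne (not_lt.1 h1) h2)
    exact div_pos (Real.sinh_pos_iff.2 (by positivity)) (by positivity)

lemma measurable_mcpFactor (K N t : ℝ) : Measurable (mcpFactor K N t) := by
  unfold mcpFactor
  refine Measurable.ite (measurableSet_singleton 0) measurable_const ?_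
  split_ifs
  · exact measurable_const
  · exact measurable_const
  · exact ((((measurable_genSin K).comp (by fun_prop)).div
      ((measurable_genSin K).comp (by fun_prop))).pow_const _).ennreal_ofReal

/-- The radius bound keeps both arguments of s_K below its first positive zero π/√K when K > 0. -/
lemma mcpFactor_pos {K N t θ : ℝ} (hN : 1 ≤ N) (ht : 0 < t) (ht1 : t ≤ 1) (hθ : 0 < θ)
    (h : 0 < K → 1 < N → θ < Real.pi * √((N - 1) / K)) : 0 < mcpFactor K N t θ := by
  unfold mcpFactor
  rw [if_neg hθ.ne']
  split_ifs with h1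
  · simp
  · simp
  · have hN1 : 0 < N - 1 := sub_pos.2 (lt_of_le_of_ne hN (Ne.symm h1))
    have hs : 0 < √(N - 1) := Real.sqrt_pos.2 hN1
    have hbound : 0 < K → √K * (θ / √(N - 1)) < Real.pi := fun hK => by
      have hK' : 0 < √K := Real.sqrt_pos.2 hK
      have := h hK (by linarith)
      rw [Real.sqrt_div hN1.le, ← mul_div_assoc, lt_div_iff₀ hK'] at this
      rw [← mul_div_assoc, div_lt_iff₀ hs]
      linarith
    have hle : t * θ / √(N - 1) ≤ θ / √(N - 1) := by
      gcongr
      exact mul_le_of_le_one_left hθ.le ht1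
    rw [ENNReal.ofReal_pos]
    refine Real.rpow_pos_of_pos (div_pos (genSin_pos (by positivity) fun hK => ?_)
      (genSin_pos (by positivity) hbound)) _
    exact (mul_le_mul_of_nonneg_left hle (Real.sqrt_nonneg K)).trans_lt (hbound hK)

lemma volume_ker_eq_zero {l : Heisenberg →ₗ[ℝ] ℝ} (hl : l ≠ 0) :
    volume {g : Heisenberg | l g = 0} = 0 := by
  have : (volume : Measure (ℝ × ℝ)).IsAddHaarMeasure := Measure.prod.instIsAddHaarMeasure _ _
  have : (volume : Measure Heisenberg).IsAddHaarMeasure := Measure.prod.instIsAddHaarMeasure _ _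
  exact Measure.addHaar_submodule volume (LinearMap.ker l) (LinearMap.ker_eq_top.not.2 hl)

namespace HasCollapsingGeodesics

variable {d : Heisenberg → Heisenberg → ℝ≥0∞}

/-- At t = 1/8 all the mass sits in a null plane although its weight is positive. Small r puts Ω
inside the ball required when K > 0 and N > 1; the measurable D stands in for the distance, so that
a vanishing integral forces the weight to vanish almost everywhere. -/
lemma not_mcp (h : HasCollapsingGeodesics d) {K N : ℝ} (hN : 1 ≤ N) :
    ¬ MCP d (volume : Measure Heisenberg) K N := by
  intro hM
  obtain ⟨l, hl, h⟩ := h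
  obtain ⟨r, hr, hrK⟩ : ∃ r > 0, 0 < K → 1 < N → r ≤ Real.pi * √((N - 1) / K) := by
    by_cases hc : 0 < K ∧ 1 < N
    · exact ⟨Real.pi * √((N - 1) / K), mul_pos Real.pi_pos
        (Real.sqrt_pos.2 (div_pos (sub_pos.2 hc.2) hc.1)), fun _ _ => le_rfl⟩
    · exact ⟨1, one_pos, fun h1 h2 => absurd ⟨h1, h2⟩ hc⟩
  obtain ⟨Ω, D, hΩ, hne, hbd, hD, hdist, hgeo⟩ := h r hr
  have hΩ0 : 0 < volume Ω := hΩ.measure_pos _ hne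
  obtain ⟨P, hP, hP0, hP1, hPt⟩ := hM (0, 0, 0) Ω hΩ.measurableSet hΩ0 hbd.measure_lt_top
    fun hK hN1 y hy => by
      rw [(hdist y hy).2.2]
      exact (ENNReal.ofReal_lt_ofReal_iff_of_nonneg (hdist y hy).1.le).2
        ((hdist y hy).2.1.trans_le (hrK hK hN1))
  have meas : ∀ t : unitInterval, Measurable fun γ : GeodesicSpace d => γ.1 t := fun t =>
    (measurable_pi_apply t).comp measurable_subtype_coe
  have ae0 : ∀ᵐ γ ∂P, γ.1 0 = (0, 0, 0) := by
    refine ae_of_ae_map (p := fun g => g = (0, 0, 0)) (meas 0).aemeasurable ?_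
    rw [hP0, ae_dirac_eq]
    exact Filter.eventually_pure.2 rfl
  have ae1 : ∀ᵐ γ ∂P, γ.1 1 ∈ Ω := by
    refine ae_of_ae_map (p := fun g => g ∈ Ω) (meas 1).aemeasurable ?_
    rw [hP1]
    exact Measure.ae_smul_measure (ae_restrict_mem hΩ.measurableSet) _
  obtain ⟨t, ht⟩ : ∃ t : unitInterval, (t : ℝ) = 1 / 8 := ⟨⟨1 / 8, by norm_num, by norm_num⟩, rfl⟩
  have hS : MeasurableSet {g : Heisenberg | l g = 0} :=
    (l.continuous_of_finiteDimensional.measurable) (measurableSet_singleton 0)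
  have aeS : ∀ᵐ γ ∂P, γ ∈ (fun γ : GeodesicSpace d => γ.1 t) ⁻¹' {g | l g = 0} := by
    filter_upwards [ae0, ae1] with γ h0 h1 using hgeo γ.1 γ.2 h0 h1 t ht.le
  have hle := hPt t {g : Heisenberg | l g = 0}
  rw [volume_ker_eq_zero hl, Measure.map_apply (meas t) hS, withDensity_apply _ (meas t hS),
    Measure.restrict_eq_self_of_ae_mem aeS, nonpos_iff_eq_zero] at hle
  have hcongr : (fun γ : GeodesicSpace d => ENNReal.ofReal t *
      mcpFactor K N t (d (γ.1 0) (γ.1 1)).toReal * volume Ω) =ᵐ[P]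
      fun γ => ENNReal.ofReal t * mcpFactor K N t (D (γ.1 1)) * volume Ω := by
    filter_upwards [ae0, ae1] with γ h0 h1
    rw [h0, (hdist _ h1).2.2, ENNReal.toReal_ofReal (hdist _ h1).1.le]
  rw [lintegral_congr_ae hcongr, lintegral_eq_zero_iff] at hle
  · have hfalse : ∀ᵐ γ ∂P, False := by
      filter_upwards [hle, ae1] with γ hγ h1
      obtain ⟨hD0, hDr, -⟩ := hdist _ h1
      have ht0 : (0 : ℝ) < t := by rw [ht]; norm_num
      exact (mul_ne_zero (mul_ne_zero (ENNReal.ofReal_pos.2 ht0).ne'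
        (mcpFactor_pos hN ht0 t.2.2 hD0 fun hK hN1 => hDr.trans_le (hrK hK hN1)).ne')
        hΩ0.ne') hγ
    exact hfalse.exists.elim fun _ h => h
  · exact (((measurable_mcpFactor K N t).comp (hD.comp (meas 1))).const_mul _).mul_const _

lemma exists_null_intermediateSet (h : HasCollapsingGeodesics d) :
    ∃ Ω : Set Heisenberg, MeasurableSet Ω ∧ Bornology.IsBounded Ω ∧
      0 < volume Ω ∧ volume Ω < ∞ ∧
      ∀ t : unitInterval, (t : ℝ) ≤ 1 / 8 →
        volume (intermediateSet d (0, 0, 0) Ω t) = 0 := by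
  obtain ⟨l, hl, h⟩ := h
  obtain ⟨Ω, D, hΩ, hne, hbd, -, -, hgeo⟩ := h 1 one_pos
  refine ⟨Ω, hΩ.measurableSet, hbd, hΩ.measure_pos _ hne, hbd.measure_lt_top, fun t ht => ?_⟩
  refine measure_mono_null ?_ (volume_ker_eq_zero hl)
  rintro _ ⟨γ, hγ, h0, h1, rfl⟩
  exact hgeo γ hγ h0 h1 t ht

end HasCollapsingGeodesics

theorem mainTheorem4 (p : ℝ≥0∞) (hp : p = 1 ∨ p = ∞) :
    (∀ K N : ℝ, 1 ≤ N → ¬ MCP (heisDist p) (volume : Measure Heisenberg) K N) ∧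
    ∃ Ω : Set Heisenberg, MeasurableSet Ω ∧ Bornology.IsBounded Ω ∧
      0 < volume Ω ∧ volume Ω < ∞ ∧
      ∀ t : unitInterval, (t : ℝ) ≤ 1 / 8 →
        volume (intermediateSet (heisDist p) (0, 0, 0) Ω t) = 0 :=
  ⟨fun _ _ hN => (hasCollapsingGeodesics_heisDist hp).not_mcp hN,
    (hasCollapsingGeodesics_heisDist hp).exists_null_intermediateSet⟩
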